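/- Fix $r\in\mathbb N$ (the case $r=0$, with $z^0=1$, is included) and positive integers $d_0,\dots,d_h$ with $h\ge 1$. For weights $\theta=(W_1,\dots,W_h)$ with $W_i\in\mathbb R^{d_i\times d_{i-1}}$, let $$p_\theta(x)=W_h\,\rho_r\,W_{h-1}\,\rho_r\cdots\rho_r\,W_1x,\qquad x=(x_1,\dots,x_{d_0}),$$ where $\rho_r$ raises every entry of a vector to the $r$-th power. Then $p_\theta$ is a $d_h$-tuple of real forms of degree $r^{h-1}$ in $d_0$ variables, i.e. $p_\theta\in \mathrm{Sym}_{r^{h-1}}(\mathbb R^{d_0})^{d_h}$, a finite-dimensional real vector space with coordinates the coefficients of the forms. Let $\mathcal V_{(d_0,\dots,d_h),r}$ be the Zariski closure, in this real vector space, of the set $\{p_\theta\}$ of all tuples obtained as $\theta$ ranges over all real weights, and let $\dim$ denote its dimension as a real algebraic set (the Krull dimension of its ring of polynomial functions). **Proposition (Recursive Bound).** For all positive integers $d_0,\dots,d_h$, every $r\in\mathbb N$ and every $k$ with $0<k<h$, $$\dim\mathcal V_{(d_0,\dots,d_h),r}\;\le\;\dim\mathcal V_{(d_0,\dots,d_k),r}+\dim\mathcal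 V_{(d_k,\dots,d_h),r}-d_k .$$ -/

import Mathlib

namespace PolyNet

open MvPolynomial

/-- The weights `(W₁, …, W_h)` of a network of depth `h` whose widths are `d 0, …, d h`
(only these values of `d` matter). The matrix `W i` of size `d (i + 1) × d i` is the weight
matrix leading from layer `i` to layer `i + 1`. -/
abbrev Weights (d : ℕ → ℕ) (h : ℕ) : Type :=
  (i : Fin h) → Matrix (Fin (d (i + 1))) (Fin (d i)) ℝ

/-- The output polynomials of the network `W_h ρ_r W_{h-1} ρ_r ⋯ ρ_r W₁ x` in the variables
`x = (x_0, …, x_{d 0 - 1})`, where `ρ_r` raises each entry to the `r`-th power; there is no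
activation before the first or after the last matrix. Depth `0` is the identity map. -/
noncomputable def networkPoly (d : ℕ → ℕ) (r : ℕ) :
    (h : ℕ) → Weights d h → Fin (d h) → MvPolynomial (Fin (d 0)) ℝ
  | 0, _ => fun i => X i
  | 1, W => fun i => ∑ j : Fin (d 0), C (W 0 i j) * X j
  | n + 2, W => fun i => ∑ j : Fin (d (n + 1)),
      C (W (Fin.last (n + 1)) i j) * networkPoly d r (n + 1) (fun l => W l.castSucc) j ^ r

/-- The outputs of a network of depth `h` are forms of degree `r ^ (h - 1)`. -/
theorem networkPoly_isHomogeneous (d : ℕ → ℕ) (r : ℕ) :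
    ∀ (h : ℕ) (W : Weights d h) (i : Fin (d h)),
      (networkPoly d r h W i).IsHomogeneous (r ^ (h - 1))
  | 0, _, i => by simpa [networkPoly] using isHomogeneous_X ℝ i
  | 1, W, i => by
      simp only [networkPoly]
      refine IsHomogeneous.sum _ _ _ fun j _ => ?_
      simpa using (isHomogeneous_C (Fin (d 0)) (W 0 i j)).mul (isHomogeneous_X ℝ j)
  | n + 2, W, i => by
      simp only [networkPoly]
      refine IsHomogeneous.sum _ _ _ fun j _ => ?_
      have key := (isHomogeneous_C (Fin (d 0)) (W (Fin.last (n + 1)) i j)).mul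
        ((networkPoly_isHomogeneous d r (n + 1) (fun l => W l.castSucc) j).pow r)
      simpa [pow_succ] using key

/-- The space `Sym_D(ℝⁿ)^m` of `m`-tuples of real forms of degree `D` in `n` variables. -/
abbrev FormTuple (m n D : ℕ) : Type :=
  Fin m → homogeneousSubmodule (Fin n) ℝ D

/-- Index set of the coefficients of an element of `FormTuple m n D`: a component together
with a monomial of degree `D` in `n` variables. -/
abbrev CoeffIndex (m n D : ℕ) : Type :=
  Fin m × {a : Fin n →₀ ℕ // a.degree = D}

/-- The coordinates on `FormTuple m n D` given by the coefficients of the forms. -/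
noncomputable def coords {m n D : ℕ} (p : FormTuple m n D) : CoeffIndex m n D → ℝ :=
  fun c => coeff c.2.1 (p c.1 : MvPolynomial (Fin n) ℝ)

/-- Zariski closure of a set of tuples of forms: the common zeros of all polynomials in the
coefficients that vanish on the set. -/
noncomputable def zariskiClosure {m n D : ℕ} (S : Set (FormTuple m n D)) :
    Set (FormTuple m n D) :=
  {p | coords p ∈ zeroLocus ℝ (vanishingIdeal ℝ (coords '' S))}

/-- Dimension of a Zariski closed set `V` of tuples of forms: the Krull dimension of its
coordinate ring, that is, of the ring of polynomials in the coefficients modulo those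
vanishing on `V`. -/
noncomputable def varietyDim {m n D : ℕ} (V : Set (FormTuple m n D)) : WithBot ℕ∞ :=
  ringKrullDim (MvPolynomial (CoeffIndex m n D) ℝ ⧸ vanishingIdeal ℝ (coords '' V))

/-- The network map `Φ_{d,r}`, sending the weights to the tuple of output polynomials. -/
noncomputable def networkMap (d : ℕ → ℕ) (h r : ℕ) (W : Weights d h) :
    FormTuple (d h) (d 0) (r ^ (h - 1)) :=
  fun i => ⟨networkPoly d r h W i, networkPoly_isHomogeneous d r h W i⟩

/-- The functional space `F_{(d 0, …, d h), r}`: the image of the network map. -/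
def functionalSpace (d : ℕ → ℕ) (h r : ℕ) : Set (FormTuple (d h) (d 0) (r ^ (h - 1))) :=
  Set.range (networkMap d h r)

/-- The functional variety `V_{(d 0, …, d h), r}`: the Zariski closure of the functional
space. -/
noncomputable def functionalVariety (d : ℕ → ℕ) (h r : ℕ) :
    Set (FormTuple (d h) (d 0) (r ^ (h - 1))) :=
  zariskiClosure (functionalSpace d h r)

end PolyNet

/-! The dimension of a functional variety is the transcendence degree over ℝ of the coefficients at
generic weights, i.e. their rank in the algebraic matroid of a field (`varietyDim_eq_eRk_coeffVec`);
arbitrary weights over a field give at most this rank (`eRk_coeffVec_le_varietyDim`).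

Cut the generic network at layer `k`. Scaling the outputs of the first half by `c⁻¹` and the columns
of the next matrix by `c ^ r` leaves the composition unchanged (`net_eq_bind₁`). Take for `c` the
outputs at the input `(1, …, 1)`, so the first half is normalised to take the value 1 there. The
coefficients of the whole network are polynomials in those of the two halves, so its rank is at most
the sum of theirs. The normalised half loses `d k` dimensions: scaling its outputs by `d k` new
variables raises the rank by `d k` within the same variety (`eRk_coeffVec_add_le_varietyDim`). -/

open MvPolynomial

/-! ### Krull dimension and algebraic matroid rank -/

/-- Krull dimension is invariant under injective integral extensions. -/
theorem ringKrullDim_eq_of_isIntegral_of_injective (R S : Type*) [CommRing R] [CommRing S]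
    [Algebra R S] [Algebra.IsIntegral R S] (hinj : Function.Injective (algebraMap R S)) :
    ringKrullDim S = ringKrullDim R := by
  apply le_antisymm
  -- Incomparability: contraction of primes is strictly monotone.
  · refine Order.krullDim_le_of_strictMono (PrimeSpectrum.comap (algebraMap R S)) ?_
    intro p q hpq
    have := p.2
    exact Ideal.IsIntegral.comap_lt_comap (R := R) (I := p.asIdeal) (J := q.asIdeal) hpq
  -- Lying over lifts the bottom of a chain, going up lifts the rest.
  · refine iSup_le fun l => ?_
    obtain ⟨P, -, hP, hPl⟩ := Ideal.exists_ideal_over_prime_of_isIntegral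
      (S := S) l.head.asIdeal ⊥ (by
        rw [← RingHom.ker_eq_comap_bot, (RingHom.injective_iff_ker_eq_bot _).1 hinj]
        exact bot_le)
    have : P.LiesOver l.head.asIdeal := ⟨hPl.symm⟩
    obtain ⟨L, hL, -⟩ := Ideal.exists_ltSeries_of_hasGoingUp l P
    rw [← hL]
    exact le_iSup (fun l : LTSeries (PrimeSpectrum S) => (l.length : WithBot ℕ∞)) L

/-- For a finite family `f` in a field extension `L / k`, the Krull dimension of the algebra of
polynomial expressions in `f` is the rank of `f` in the algebraic matroid. -/
theorem ringKrullDim_quotient_ker_aeval {k L ι : Type*} [Field k] [Field L] [Algebra k L]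
    [Finite ι] (f : ι → L) :
    ringKrullDim (MvPolynomial ι k ⧸ RingHom.ker (aeval (R := k) f)) =
      ((AlgebraicIndependent.matroid k L).eRk (Set.range f) : WithBot ℕ∞) := by
  set A := (aeval (R := k) f).range with hA
  have hA' : A = Algebra.adjoin k (Set.range f) := (Algebra.adjoin_range_eq_range_aeval k f).symm
  rw [ringKrullDim_eq_of_ringEquiv
    (Ideal.quotientKerEquivRange (aeval (R := k) f)).toRingEquiv]
  have : Algebra.FiniteType k A :=
    A.fg_iff_finiteType.1 ⟨(Set.finite_range f).toFinset, by simp [hA']⟩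
  -- Noether normalisation; the images `x` of the variables form a transcendence basis with the same
  -- matroid closure as `f`.
  obtain ⟨s, g, hg, hfin⟩ := exists_finite_inj_algHom_of_fg k A
  have hdim : ringKrullDim A = s := by
    algebraize [g.toRingHom]
    have : Algebra.IsIntegral (MvPolynomial (Fin s) k) A := ⟨hfin.to_isIntegral⟩
    rw [ringKrullDim_eq_of_isIntegral_of_injective (MvPolynomial (Fin s) k) A hg]
    simp
  rw [hdim]
  let x : Fin s → L := fun i => (g (X i) : A)
  have haev : aeval (R := k) x = A.val.comp g := by ext i; simp [x]
  have hx : AlgebraicIndependent k x := by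
    rw [AlgebraicIndependent, haev]
    exact Subtype.val_injective.comp hg
  have hxA : Set.range x ⊆ (A : Set L) := by rintro _ ⟨i, rfl⟩; exact (g (X i)).2
  have hindep : (AlgebraicIndependent.matroid k L).Indep (Set.range x) := by
    rw [AlgebraicIndependent.matroid_indep_iff]
    exact hx.to_subtype_range
  have hAx : (A : Set L) ⊆ (AlgebraicIndependent.matroid k L).closure (Set.range x) := by
    intro a ha
    rw [AlgebraicIndependent.matroid_closure_eq]
    obtain ⟨p, hp, hp0⟩ := hfin.to_isIntegral ⟨a, ha⟩
    rw [SetLike.mem_coe, Subalgebra.mem_algebraicClosure]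
    let φ : MvPolynomial (Fin s) k →+* Algebra.adjoin k (Set.range x) :=
      ((aeval (R := k) x).codRestrict (Algebra.adjoin k (Set.range x)) fun q => by
        rw [Algebra.adjoin_range_eq_range_aeval]; exact ⟨q, rfl⟩ : _ →ₐ[k] _)
    apply IsIntegral.isAlgebraic
    refine ⟨p.map φ, hp.map φ, ?_⟩
    have h2 := congrArg (A.val : A →+* L) hp0
    rw [Polynomial.hom_eval₂, map_zero] at h2
    rw [Polynomial.eval₂_map, ← h2]
    congr 1
    ext q
    · simp [φ]
    · simp [φ, x]
  have hcl : (AlgebraicIndependent.matroid k L).eRk (Set.range f) =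
      (AlgebraicIndependent.matroid k L).eRk (Set.range x) := by
    apply le_antisymm
    · rw [← Matroid.eRk_closure_eq _ (Set.range x)]
      refine Matroid.eRk_mono _ (subset_trans ?_ hAx)
      rw [hA']; exact Algebra.subset_adjoin
    · rw [← Matroid.eRk_closure_eq _ (Set.range f)]
      refine Matroid.eRk_mono _ (subset_trans hxA ?_)
      intro a ha
      rw [AlgebraicIndependent.matroid_closure_eq, SetLike.mem_coe, Subalgebra.mem_algebraicClosure]
      rw [hA'] at ha
      exact isAlgebraic_algebraMap (⟨a, ha⟩ : Algebra.adjoin k (Set.range f))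
  rw [hcl, hindep.eRk_eq_encard, ← Set.image_univ, hx.injective.encard_image]
  simp

/-! ### Networks over arbitrary commutative rings -/

namespace PolyNet

/-- Weights in a ring `A` for a network with infinitely many layers of widths `d 0, d 1, …`. -/
abbrev SeqWeights (d : ℕ → ℕ) (A : Type*) : Type _ :=
  (i : ℕ) → Matrix (Fin (d (i + 1))) (Fin (d i)) A

/-- The output of layer `n` of a network with weights `W` and input `x`. -/
def act {A : Type*} [CommRing A] (d : ℕ → ℕ) (r : ℕ) (W : SeqWeights d A) (x : Fin (d 0) → A) :
    (n : ℕ) → Fin (d n) → A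
  | 0 => x
  | 1 => fun i => ∑ j, W 0 i j * x j
  | n + 2 => fun i => ∑ j, W (n + 1) i j * act d r W x (n + 1) j ^ r

/-- The output polynomials of layer `n` of a network with weights `W`. -/
noncomputable def net {A : Type*} [CommRing A] (d : ℕ → ℕ) (r : ℕ) (W : SeqWeights d A) (n : ℕ) :
    Fin (d n) → MvPolynomial (Fin (d 0)) A :=
  act d r (fun i => (W i).map C) X n

section act

variable {A B : Type*} [CommRing A] [CommRing B] (d : ℕ → ℕ) (r : ℕ)

theorem map_act (φ : A →+* B) (W : SeqWeights d A) (x : Fin (d 0) → A) :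
    ∀ (n : ℕ) (i : Fin (d n)),
      φ (act d r W x n i) = act d r (fun l => (W l).map φ) (fun j => φ (x j)) n i
  | 0, i => rfl
  | 1, i => by simp [act]
  | n + 2, i => by simp [act, map_act φ W x (n + 1)]

theorem act_congr {W W' : SeqWeights d A} (x : Fin (d 0) → A) :
    ∀ {n : ℕ}, (∀ i < n, W i = W' i) → act d r W x n = act d r W' x n
  | 0, _ => rfl
  | 1, h => by simp [act, h 0 one_pos]
  | n + 2, h => by
      funext i
      simp only [act]
      rw [h (n + 1) (by omega), act_congr x fun i hi => h i (by omega)]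

theorem act_update_last (W : SeqWeights d A) (x : Fin (d 0) → A) (n : ℕ)
    (s : Fin (d (n + 1)) → A) (i : Fin (d (n + 1))) :
    act d r (Function.update W n (Matrix.diagonal s * W n)) x (n + 1) i =
      s i * act d r W x (n + 1) i := by
  cases n with
  | zero => simp [act, Finset.mul_sum, mul_assoc]
  | succ n =>
    simp only [act]
    rw [act_congr d r x (W' := W) fun i hi => Function.update_of_ne (by omega) _ _]
    simp [Finset.mul_sum, mul_assoc]

theorem act_update_first (W : SeqWeights d A) (x s : Fin (d 0) → A) :
    ∀ n : ℕ, act d r (Function.update W 0 (W 0 * Matrix.diagonal s)) x (n + 1) =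
      act d r W (fun j => s j * x j) (n + 1)
  | 0 => by funext i; simp [act, mul_assoc]
  | n + 1 => by
    funext i
    simp only [act]
    rw [act_update_first W x s n]
    simp

theorem act_add (W : SeqWeights d A) (x : Fin (d 0) → A) (k : ℕ) :
    ∀ m : ℕ, act d r W x (k + 1 + (m + 1)) =
      act (fun i => d (k + 1 + i)) r (fun i => W (k + 1 + i))
        (fun j => act d r W x (k + 1) j ^ r) (m + 1)
  | 0 => rfl
  | m + 1 => by
    funext i
    have := act_add W x k m
    change ∑ j, W (k + 1 + m + 1) i j * act d r W x (k + 1 + (m + 1)) j ^ r = _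
    rw [this]
    rfl

/-- Supplies the real specialisation showing that generic outputs at `(1, …, 1)` are nonzero; empty
layers would make the sums vanish. -/
theorem act_pos :
    ∀ (n : ℕ) (_ : ∀ i < n, 0 < d i) (i : Fin (d n)), 0 < act d r (fun _ => Matrix.of fun _ _ => (1 : ℝ)) (fun _ => 1) n i
  | 0, _, i => one_pos
  | 1, hd, i => by simp [act, hd 0]
  | n + 2, hd, i => by
    simp only [act]
    have : Nonempty (Fin (d (n + 1))) := ⟨⟨0, hd _ (by omega)⟩⟩
    refine Finset.sum_pos (fun j _ => ?_) Finset.univ_nonempty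
    have := act_pos (n + 1) (fun i hi => hd i (by omega)) j
    simp only [Matrix.of_apply, one_mul]
    positivity

end act

section net

variable {A B : Type*} [CommRing A] [CommRing B] (d : ℕ → ℕ) (r : ℕ)

theorem map_net (φ : A →+* B) (W : SeqWeights d A) (n : ℕ) (i : Fin (d n)) :
    map φ (net d r W n i) = net d r (fun l => (W l).map φ) n i := by
  rw [net, map_act, net]
  congr 1
  · funext l; ext a b; simp
  · funext j; simp

theorem aeval_net [Algebra A B] (x : Fin (d 0) → B) (W : SeqWeights d A) (n : ℕ) (i : Fin (d n)) :
    aeval x (net d r W n i) = act d r (fun l => (W l).map (algebraMap A B)) x n i := by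
  have := map_act d r (aeval (R := A) x : _ →+* B) (fun l => (W l).map C) X n i
  rw [net]
  refine this.trans ?_
  congr 1
  · funext l; ext a b; simp
  · funext j; simp

theorem net_isHomogeneous (W : SeqWeights d A) :
    ∀ (n : ℕ) (i : Fin (d n)), (net d r W n i).IsHomogeneous (r ^ (n - 1))
  | 0, i => by simpa [net, act] using isHomogeneous_X A i
  | 1, i => by
      refine IsHomogeneous.sum _ _ _ fun j _ => ?_
      simpa using (isHomogeneous_C (Fin (d 0)) (W 0 i j)).mul (isHomogeneous_X A j)
  | n + 2, i => by
      refine IsHomogeneous.sum _ _ _ fun j _ => ?_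
      have key := (isHomogeneous_C (Fin (d 0)) (W (n + 1) i j)).mul
        ((net_isHomogeneous W (n + 1) j).pow r)
      simpa [pow_succ, net] using key

theorem net_update_last (W : SeqWeights d A) (n : ℕ)
    (s : Fin (d (n + 1)) → A) (i : Fin (d (n + 1))) :
    net d r (Function.update W n (Matrix.diagonal s * W n)) (n + 1) i =
      C (s i) * net d r W (n + 1) i := by
  refine Eq.trans ?_ (act_update_last d r (fun i => (W i).map C) X n (fun j => C (s j)) i)
  rw [net]
  congr 1
  funext l
  by_cases h : l = n
  · subst h
    simp [Matrix.map_mul, Matrix.diagonal_map]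
  · simp [h]

theorem networkPoly_eq_net (W : SeqWeights d ℝ) :
    ∀ (n : ℕ), networkPoly d r n (fun i => W i) = net d r W n
  | 0 => rfl
  | 1 => rfl
  | n + 2 => by
    funext i
    simp only [networkPoly, net, act]
    have := networkPoly_eq_net W (n + 1)
    simp only [net] at this
    simp [this]

/-- The coefficients of the output polynomials of layer `n`. -/
noncomputable def coeffVec (W : SeqWeights d A) (n : ℕ) :
    CoeffIndex (d n) (d 0) (r ^ (n - 1)) → A :=
  fun c => coeff c.2.1 (net d r W n c.1)

/-- `coeffVec` lists only the coefficients of degree `r ^ (n - 1)`; by homogeneity all others are 0.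
-/
theorem coeff_net_mem (S : Set A) (h0 : (0 : A) ∈ S) (W : SeqWeights d A) (n : ℕ)
    (h : Set.range (coeffVec d r W n) ⊆ S) (i : Fin (d n)) (a : Fin (d 0) →₀ ℕ) :
    coeff a (net d r W n i) ∈ S := by
  by_cases ha : a.degree = r ^ (n - 1)
  · exact h ⟨(i, ⟨a, ha⟩), rfl⟩
  · rwa [(net_isHomogeneous d r W n i).coeff_eq_zero ha]

theorem map_coeffVec (φ : A →+* B) (W : SeqWeights d A) (n : ℕ)
    (c : CoeffIndex (d n) (d 0) (r ^ (n - 1))) :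
    φ (coeffVec d r W n c) = coeffVec d r (fun l => (W l).map φ) n c := by
  rw [coeffVec, coeffVec, ← map_net, coeff_map]

end net

/-! ### Dimension of the variety via generic weights -/

instance (m n D : ℕ) : Finite (CoeffIndex m n D) := by
  have : Finite {a : Fin n →₀ ℕ // a.degree = D} := by
    refine Set.Finite.to_subtype ?_
    refine (Finset.finite_toSet (Finset.univ.finsuppAntidiag D)).subset fun a ha => ?_
    simp only [Finset.mem_coe, Finset.mem_finsuppAntidiag]
    refine ⟨?_, Finset.subset_univ _⟩
    rw [← (show a.degree = D from ha), Finsupp.degree_eq_sum]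
  infer_instance

theorem vanishingIdeal_zariskiClosure {m n D : ℕ} (S : Set (FormTuple m n D)) :
    vanishingIdeal ℝ (coords '' zariskiClosure S) = vanishingIdeal ℝ (coords '' S) := by
  apply le_antisymm
  · apply vanishingIdeal_anti_mono
    refine Set.image_mono fun p hp => ?_
    exact zeroLocus_vanishingIdeal_le (k := ℝ) (coords '' S) ⟨p, hp, rfl⟩
  · refine (le_vanishingIdeal_zeroLocus _).trans (vanishingIdeal_anti_mono ?_)
    rintro _ ⟨p, hp, rfl⟩
    exact hp

variable (d : ℕ → ℕ) (r : ℕ)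

theorem mem_vanishingIdeal_functionalVariety (h : ℕ)
    (P : MvPolynomial (CoeffIndex (d h) (d 0) (r ^ (h - 1))) ℝ) :
    P ∈ vanishingIdeal ℝ (coords '' functionalVariety d h r) ↔
      ∀ W : SeqWeights d ℝ, aeval (coeffVec d r W h) P = 0 := by
  have key : ∀ W : SeqWeights d ℝ,
      coords (networkMap d h r fun i => W i) = coeffVec d r W h := by
    intro W
    funext c
    simp [coords, networkMap, coeffVec, networkPoly_eq_net]
  rw [functionalVariety, vanishingIdeal_zariskiClosure, mem_vanishingIdeal_iff]
  constructor
  · intro H W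
    rw [← key]
    exact H _ ⟨_, ⟨_, rfl⟩, rfl⟩
  · rintro H _ ⟨_, ⟨W, rfl⟩, rfl⟩
    -- Layers beyond depth `h` do not matter, so they are filled with 0.
    let W' : SeqWeights d ℝ := fun l => if hl : l < h then W ⟨l, hl⟩ else 0
    have : W = fun i : Fin h => W' i := by
      funext i; simp [W']
    rw [this, key W']
    exact H _

/-- The entries of all weight matrices. -/
abbrev WeightIndex : Type := Σ i : ℕ, Fin (d (i + 1)) × Fin (d i)

/-- The entries of the weights `W` as a family. -/
def SeqWeights.entries {d : ℕ → ℕ} {A : Type*} (W : SeqWeights d A) : WeightIndex d → A :=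
  fun s => W s.1 s.2.1 s.2.2

/-- The weights whose entries are independent variables. -/
noncomputable def genericWeights : SeqWeights d (MvPolynomial (WeightIndex d) ℝ) :=
  fun i => Matrix.of fun a b => X ⟨i, a, b⟩

/-- Every choice of weights is a specialisation of the generic one. -/
theorem aeval_coeffVec {A : Type*} [CommRing A] [Algebra ℝ A] (W : SeqWeights d A) (h : ℕ)
    (P : MvPolynomial (CoeffIndex (d h) (d 0) (r ^ (h - 1))) ℝ) :
    aeval (coeffVec d r W h) P =
      aeval W.entries (aeval (coeffVec d r (genericWeights d) h) P) := by
  refine Eq.trans ?_ (comp_aeval_apply _ (aeval W.entries) P).symm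
  congr 2
  funext c
  have := map_coeffVec d r (aeval (R := ℝ) W.entries : _ →+* A) (genericWeights d) h c
  refine Eq.trans ?_ this.symm
  congr 1
  funext l; ext a b
  simp [genericWeights, SeqWeights.entries]

theorem mem_vanishingIdeal_functionalVariety_iff_generic (h : ℕ)
    (P : MvPolynomial (CoeffIndex (d h) (d 0) (r ^ (h - 1))) ℝ) :
    P ∈ vanishingIdeal ℝ (coords '' functionalVariety d h r) ↔
      aeval (coeffVec d r (genericWeights d) h) P = 0 := by
  rw [mem_vanishingIdeal_functionalVariety]
  constructor
  · intro H
    -- ℝ is infinite, so a polynomial in the weights vanishing at all real points is 0.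
    apply MvPolynomial.funext
    intro w
    have := H fun i => Matrix.of fun a b => w ⟨i, a, b⟩
    rw [aeval_coeffVec] at this
    rw [map_zero, ← this]
    rfl
  · intro H W
    rw [aeval_coeffVec, H, map_zero]

/-- The rank of the coefficients of any network in the algebraic matroid of a field is at most
the dimension of the functional variety. -/
theorem eRk_coeffVec_le_varietyDim {L : Type*} [Field L] [Algebra ℝ L] (W : SeqWeights d L)
    (h : ℕ) :
    ((AlgebraicIndependent.matroid ℝ L).eRk (Set.range (coeffVec d r W h)) : WithBot ℕ∞) ≤
      varietyDim (functionalVariety d h r) := by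
  rw [← ringKrullDim_quotient_ker_aeval, varietyDim]
  -- Relations between generic coefficients survive specialisation, so the algebra of the
  -- coefficients of `W` is a quotient of the coordinate ring.
  refine ringKrullDim_le_of_surjective (Ideal.Quotient.factor ?_)
    (Ideal.Quotient.factor_surjective _)
  intro P hP
  rw [mem_vanishingIdeal_functionalVariety_iff_generic] at hP
  rw [RingHom.mem_ker, aeval_coeffVec, hP, map_zero]

theorem mem_vanishingIdeal_iff_of_algebraicIndependent {L : Type*} [Field L] [Algebra ℝ L]
    (W : SeqWeights d L) (hW : AlgebraicIndependent ℝ W.entries) (h : ℕ)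
    (P : MvPolynomial (CoeffIndex (d h) (d 0) (r ^ (h - 1))) ℝ) :
    P ∈ vanishingIdeal ℝ (coords '' functionalVariety d h r) ↔
      aeval (coeffVec d r W h) P = 0 := by
  rw [mem_vanishingIdeal_functionalVariety_iff_generic, aeval_coeffVec d r W,
    map_eq_zero_iff _ hW]

theorem varietyDim_eq_eRk_coeffVec {L : Type*} [Field L] [Algebra ℝ L]
    (W : SeqWeights d L) (hW : AlgebraicIndependent ℝ W.entries) (h : ℕ) :
    varietyDim (functionalVariety d h r) =
      ((AlgebraicIndependent.matroid ℝ L).eRk (Set.range (coeffVec d r W h)) : WithBot ℕ∞) := by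
  rw [← ringKrullDim_quotient_ker_aeval, varietyDim]
  have : vanishingIdeal ℝ (coords '' functionalVariety d h r) =
      RingHom.ker (aeval (R := ℝ) (coeffVec d r W h)) :=
    Ideal.ext fun P => mem_vanishingIdeal_iff_of_algebraicIndependent d r W hW h P
  rw [this]

end PolyNet

/-! ### Polynomials with coefficients in a subalgebra -/

theorem AlgebraicIndependent.adjoin_subset_matroid_closure {k L : Type*} [Field k] [Field L]
    [Algebra k L] (s : Set L) :
    (Algebra.adjoin k s : Set L) ⊆ (AlgebraicIndependent.matroid k L).closure s := by
  intro a ha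
  rw [AlgebraicIndependent.matroid_closure_eq, SetLike.mem_coe, Subalgebra.mem_algebraicClosure]
  exact isAlgebraic_algebraMap (⟨a, ha⟩ : Algebra.adjoin k s)

theorem MvPolynomial.exists_map_val_eq {k A σ : Type*} [CommRing k] [CommRing A] [Algebra k A]
    (S : Subalgebra k A) (f : MvPolynomial σ A) (hf : ∀ a, coeff a f ∈ S) :
    ∃ g : MvPolynomial σ S, map (S.val : S →+* A) g = f := by
  refine mem_range_map_iff_coeffs_subset.2 fun x hx => ?_
  obtain ⟨a, -, rfl⟩ := mem_coeffs_iff.1 (Finset.mem_coe.1 hx)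
  exact ⟨⟨_, hf a⟩, rfl⟩

/-- Both polynomials descend to `S`, and substitution commutes with the inclusion of `S`. -/
theorem MvPolynomial.coeff_bind₁_mem {k A σ τ : Type*} [CommRing k] [CommRing A] [Algebra k A]
    (S : Subalgebra k A) (p : σ → MvPolynomial τ A) (q : MvPolynomial σ A)
    (hp : ∀ j a, coeff a (p j) ∈ S) (hq : ∀ a, coeff a q ∈ S) (a : τ →₀ ℕ) :
    coeff a (bind₁ p q) ∈ S := by
  choose p' hp' using fun j => exists_map_val_eq S (p j) (hp j)
  obtain ⟨q', rfl⟩ := exists_map_val_eq S q hq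
  obtain rfl : (fun j => map (S.val : S →+* A) (p' j)) = p := _root_.funext hp'
  rw [← map_bind₁, coeff_map]
  exact (coeff a (bind₁ p' q')).2

theorem MvPolynomial.coeff_pow_mem {k A σ : Type*} [CommRing k] [CommRing A] [Algebra k A]
    (S : Subalgebra k A) (p : MvPolynomial σ A) (hp : ∀ a, coeff a p ∈ S) (r : ℕ) (a : σ →₀ ℕ) :
    coeff a (p ^ r) ∈ S := by
  obtain ⟨p', rfl⟩ := exists_map_val_eq S p hp
  rw [← map_pow, coeff_map]
  exact (coeff a (p' ^ r)).2

/-! ### Cutting, normalising and rescaling -/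

namespace PolyNet

variable (d : ℕ → ℕ) (r : ℕ)

/-- A network of depth `k + 1 + (m + 1)` is the composition of two networks, where the outputs of
the first one may be rescaled. -/
theorem net_eq_bind₁ {K : Type*} [Field K] (W : SeqWeights d K) (k m : ℕ)
    (c : Fin (d (k + 1)) → K) (hc : ∀ j, c j ≠ 0) (i : Fin (d (k + 1 + (m + 1)))) :
    net d r W (k + 1 + (m + 1)) i =
      bind₁ (fun j => net d r (Function.update W k (Matrix.diagonal c⁻¹ * W k)) (k + 1) j ^ r)
        (net (fun i => d (k + 1 + i)) r
          (Function.update (fun i => W (k + 1 + i)) 0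
            (W (k + 1) * Matrix.diagonal (fun j => c j ^ r))) (m + 1) i) := by
  have h1 : ∀ j, net d r W (k + 1) j =
      C (c j) * net d r (Function.update W k (Matrix.diagonal c⁻¹ * W k)) (k + 1) j := by
    intro j
    rw [net_update_last, ← mul_assoc, ← C_mul]
    simp [hc j]
  have h2 := act_update_first (fun i => d (k + 1 + i)) r
    (fun i => (W (k + 1 + i)).map (C : K →+* MvPolynomial (Fin (d 0)) K))
    (fun j => net d r (Function.update W k (Matrix.diagonal c⁻¹ * W k)) (k + 1) j ^ r)
    (fun j => C (c j ^ r)) m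
  rw [net, act_add, bind₁]
  refine Eq.trans ?_ (aeval_net (fun i => d (k + 1 + i)) r _ _ (m + 1) i).symm
  change act (fun i => d (k + 1 + i)) r (fun i => (W (k + 1 + i)).map C)
    (fun j => net d r W (k + 1) j ^ r) (m + 1) i = _
  have h3 : (fun j => net d r W (k + 1) j ^ r) = fun j => C (c j ^ r) *
      net d r (Function.update W k (Matrix.diagonal c⁻¹ * W k)) (k + 1) j ^ r := by
    funext j
    rw [h1 j, mul_pow, C_pow]
  rw [h3]
  refine (congrFun h2 i).symm.trans ?_
  congr 1
  funext l
  by_cases h : l = 0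
  · subst h
    simp [Matrix.map_mul, Matrix.diagonal_map, MvPolynomial.algebraMap_eq]
  · simp [h, MvPolynomial.algebraMap_eq]

/-- The value of a polynomial at `(1, …, 1)` is the sum of its coefficients. -/
theorem act_one_mem_adjoin {A : Type*} [CommRing A] [Algebra ℝ A] (W : SeqWeights d A) (n : ℕ)
    (i : Fin (d n)) :
    act d r W (fun _ => 1) n i ∈ Algebra.adjoin ℝ (Set.range (coeffVec d r W n)) := by
  have h := aeval_net (B := A) d r (fun _ => 1) W n i
  have hW : (fun l => (W l).map (algebraMap A A)) = W := by funext l; ext a b; simp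
  rw [hW, aeval_def, eval₂_eq] at h
  rw [← h]
  refine Subalgebra.sum_mem _ fun a _ => ?_
  simpa using coeff_net_mem d r (Algebra.adjoin ℝ (Set.range (coeffVec d r W n)) : Set A)
    (zero_mem _) W n Algebra.subset_adjoin i a

/-- A normalised network can be rescaled in `d (k + 1)` independent directions. -/
theorem eRk_coeffVec_add_le_varietyDim {K : Type*} [Field K] [Algebra ℝ K] (W : SeqWeights d K)
    (k : ℕ) (hW : ∀ j, act d r W (fun _ => 1) (k + 1) j = 1) :
    (((AlgebraicIndependent.matroid ℝ K).eRk (Set.range (coeffVec d r W (k + 1))) +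
      (d (k + 1) : ℕ∞) : ℕ∞) : WithBot ℕ∞) ≤ varietyDim (functionalVariety d (k + 1) r) := by
  let L := FractionRing (MvPolynomial (Fin (d (k + 1))) K)
  let μ : Fin (d (k + 1)) → L := fun j => algebraMap (MvPolynomial (Fin (d (k + 1))) K) L (X j)
  have hμ : AlgebraicIndependent K μ :=
    (algebraicIndependent_X (Fin (d (k + 1))) K).map'
      (f := IsScalarTower.toAlgHom K (MvPolynomial (Fin (d (k + 1))) K) L)
      (IsFractionRing.injective _ _)
  let WL : SeqWeights d L := fun l => (W l).map (algebraMap K L)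
  let W' : SeqWeights d L := Function.update WL k (Matrix.diagonal μ * WL k)
  refine le_trans ?_ (eRk_coeffVec_le_varietyDim d r W' (k + 1))
  rw [WithBot.coe_le_coe]
  set S := Set.range (coeffVec d r W' (k + 1)) with hS
  have hcoef : ∀ c, coeffVec d r W' (k + 1) c =
      μ c.1 * algebraMap K L (coeffVec d r W (k + 1) c) := by
    intro c
    rw [map_coeffVec, coeffVec, net_update_last, coeff_C_mul]
    rfl
  have hμS : ∀ j, μ j ∈ Algebra.adjoin ℝ S := by
    intro j
    -- Normalisation lets the scale factor be read off as the value at `(1, …, 1)`.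
    have h1 : act d r W' (fun _ => 1) (k + 1) j = μ j := by
      have h2 := map_act d r (algebraMap K L) W (fun _ => 1) (k + 1) j
      rw [hW, map_one] at h2
      rw [act_update_last]
      rw [← h2, mul_one]
    rw [← h1]
    exact act_one_mem_adjoin d r W' (k + 1) j
  obtain ⟨I, hI⟩ := (AlgebraicIndependent.matroid ℝ K).exists_isBasis
    (Set.range (coeffVec d r W (k + 1))) (Set.subset_univ _)
  rw [hI.eRk_eq_encard]
  have hI' : AlgebraicIndependent ℝ ((↑) : I → K) := hI.indep
  -- Independence in the tower ℝ ⊆ K ⊆ L: `I` over ℝ, `μ` over K.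
  have hsum := hI'.sumElim_comp hμ
  have hindep : (AlgebraicIndependent.matroid ℝ L).Indep
      (Set.range (Sum.elim μ (algebraMap K L ∘ ((↑) : I → K)))) := by
    rw [AlgebraicIndependent.matroid_indep_iff]
    exact hsum.to_subtype_range
  have hcard : I.encard + (d (k + 1) : ℕ∞) =
      (Set.range (Sum.elim μ (algebraMap K L ∘ ((↑) : I → K)))).encard := by
    rw [← Set.image_univ, hsum.injective.encard_image, Set.encard_univ, ENat.card_sum]
    rw [ENat.card_eq_coe_fintype_card (α := Fin _), Fintype.card_fin, ENat.card_coe_set_eq,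
      add_comm]
  rw [hcard, ← hindep.eRk_eq_encard, ← Matroid.eRk_closure_eq _ S]
  refine Matroid.eRk_mono _ ?_
  rintro _ ⟨j | a, rfl⟩
  · exact AlgebraicIndependent.adjoin_subset_matroid_closure S (hμS j)
  · obtain ⟨c, hc⟩ := hI.subset a.2
    have hne : μ c.1 ≠ 0 := hμ.ne_zero _
    -- Dividing by the recovered factor returns the original coefficient.
    have h1 : algebraMap K L a = coeffVec d r W' (k + 1) c * (μ c.1)⁻¹ := by
      rw [hcoef, hc, mul_comm (μ _), mul_assoc, mul_inv_cancel₀ hne, mul_one]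
    rw [AlgebraicIndependent.matroid_closure_eq, SetLike.mem_coe, Subalgebra.mem_algebraicClosure]
    simp only [Sum.elim_inr, Function.comp]
    rw [h1]
    refine IsAlgebraic.mul ?_ (IsAlgebraic.inv ?_)
    · exact isAlgebraic_algebraMap
        (⟨_, Algebra.subset_adjoin ⟨c, rfl⟩⟩ : Algebra.adjoin ℝ S)
    · exact isAlgebraic_algebraMap (⟨_, hμS c.1⟩ : Algebra.adjoin ℝ S)

theorem act_one_ne_zero {L : Type*} [Field L] [Algebra ℝ L] (W : SeqWeights d L)
    (hW : AlgebraicIndependent ℝ W.entries) (n : ℕ) (hd : ∀ i < n, 0 < d i) (i : Fin (d n)) :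
    act d r W (fun _ => 1) n i ≠ 0 := by
  have h1 := map_act d r (aeval (R := ℝ) W.entries : _ →+* L) (genericWeights d) (fun _ => 1) n i
  have h2 := map_act d r (eval fun _ : WeightIndex d => (1 : ℝ)) (genericWeights d)
    (fun _ => 1) n i
  simp only [map_one] at h1 h2
  have h3 : (fun l => (genericWeights d l).map (aeval (R := ℝ) W.entries : _ →+* L)) = W := by
    funext l; ext a b; simp [genericWeights, SeqWeights.entries]
  have h4 : (fun l => (genericWeights d l).map (eval fun _ : WeightIndex d => (1 : ℝ))) =
      fun _ => Matrix.of fun _ _ => (1 : ℝ) := by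
    funext l; ext a b; simp [genericWeights]
  rw [h3] at h1
  rw [h4] at h2
  rw [← h1]
  intro h0
  -- The value is a polynomial in the weights; were it 0, so would be its positive specialisation at
  -- weights 1.
  have h5 := (map_eq_zero_iff (aeval (R := ℝ) W.entries) hW).1 h0
  rw [h5, map_zero] at h2
  exact (act_pos d r n hd i).ne h2

theorem varietyDim_add_le (k m : ℕ) (hd : ∀ i < k + 1, 0 < d i) :
    varietyDim (functionalVariety d (k + 1 + (m + 1)) r) + (d (k + 1) : WithBot ℕ∞) ≤
      varietyDim (functionalVariety d (k + 1) r) +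
        varietyDim (functionalVariety (fun i => d (k + 1 + i)) (m + 1) r) := by
  let K := FractionRing (MvPolynomial (WeightIndex d) ℝ)
  let W : SeqWeights d K := fun i => Matrix.of fun a b =>
    algebraMap (MvPolynomial (WeightIndex d) ℝ) K (X ⟨i, a, b⟩)
  have hW : AlgebraicIndependent ℝ W.entries :=
    (algebraicIndependent_X (WeightIndex d) ℝ).map'
      (f := IsScalarTower.toAlgHom ℝ (MvPolynomial (WeightIndex d) ℝ) K)
      (IsFractionRing.injective _ _)
  let c : Fin (d (k + 1)) → K := act d r W (fun _ => 1) (k + 1)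
  have hc : ∀ j, c j ≠ 0 := act_one_ne_zero d r W hW (k + 1) hd
  let W₁ : SeqWeights d K := Function.update W k (Matrix.diagonal c⁻¹ * W k)
  let W₂ : SeqWeights (fun i => d (k + 1 + i)) K := Function.update (fun i => W (k + 1 + i)) 0
    (W (k + 1) * Matrix.diagonal (fun j => c j ^ r))
  have h₁ := eRk_coeffVec_add_le_varietyDim d r W₁ k fun j => by
    rw [act_update_last]
    exact inv_mul_cancel₀ (hc j)
  have h₂ := eRk_coeffVec_le_varietyDim (fun i => d (k + 1 + i)) r W₂ (m + 1)
  rw [varietyDim_eq_eRk_coeffVec d r W hW]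
  refine le_trans ?_ (add_le_add h₁ h₂)
  norm_cast
  refine le_of_le_of_eq (add_le_add ?_ le_rfl) (add_right_comm _ _ _)
  -- Subadditivity of rank; the coefficients of the composition lie in the algebra generated by
  -- those of `W₁` and `W₂`.
  refine le_trans ?_ (Matroid.eRk_union_le_eRk_add_eRk _ _ _)
  rw [← Matroid.eRk_closure_eq _ (_ ∪ _)]
  refine Matroid.eRk_mono _ (subset_trans ?_
    (AlgebraicIndependent.adjoin_subset_matroid_closure _))
  rintro _ ⟨a, rfl⟩
  rw [coeffVec, net_eq_bind₁ d r W k m c hc]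
  refine coeff_bind₁_mem _ _ _ (fun j b => coeff_pow_mem _ _ (fun b => ?_) r b) (fun b => ?_) _
  · exact coeff_net_mem d r _ (zero_mem _) W₁ (k + 1)
      (Set.subset_union_left.trans Algebra.subset_adjoin) j b
  · exact coeff_net_mem (fun i => d (k + 1 + i)) r _ (zero_mem _) W₂ (m + 1)
      (Set.subset_union_right.trans Algebra.subset_adjoin) a.1 b

end PolyNet

theorem mainTheorem5 (d : ℕ → ℕ) (h k r : ℕ) (hk : 0 < k) (hkh : k < h)
    (hd : ∀ i ≤ h, 0 < d i) :
    PolyNet.varietyDim (PolyNet.functionalVariety d h r) + (d k : WithBot ℕ∞) ≤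
      PolyNet.varietyDim (PolyNet.functionalVariety d k r) +
        PolyNet.varietyDim (PolyNet.functionalVariety (fun i => d (k + i)) (h - k) r) := by
  obtain ⟨k, rfl⟩ := Nat.exists_eq_succ_of_ne_zero hk.ne'
  obtain ⟨m, rfl⟩ := Nat.exists_eq_add_of_lt hkh
  rw [show k.succ + m + 1 - k.succ = m + 1 by omega]
  exact PolyNet.varietyDim_add_le d r k m fun i hi => hd i (by omega)
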